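/- Let $W$ and $M$ be finite sets of women and men. Each person $p\in W\cup M$ has a quota $n_p\in\mathbb N$, a strict total order of preference on the members of the other side, and a (possibly empty) set of members of the other side whom $p$ blacklists. No relation between $\sum_{w\in W} n_w$ and $\sum_{m\in M} n_m$ is assumed. The algorithm proceeds in nights. On each night, every man $m$ serenades the $n_m$ women he prefers most among all women who have not yet rejected him, have not blacklisted him and are not blacklisted by him (all of these women, if there are fewer than $n_m$). Then every woman $w$ who is serenaded by more than $n_w$ men rejects all of them except the $n_w$ men she prefers most among them. The algorithm stops on the first night on which nobody is rejected, and each woman is then matched with all men who serenade her on that night. Let $L\subseteq W$ be a set of liars, who declare arbitrary orders of preference and blacklists; all other women and all men declare their true ones, and the quotas are unchanged. For $p\in W\cup M$ let $O(p)$ and $N(p)$ be the sets of people matched with $p$ by the algorithm when it is run on the true and on the declared preferences, respectively. For a woman $w$, let $o^w_1,o^w_2,\dots$ and $n^w_1,n^w_2,\dots$ be the elements of $O(w)$ and of $N(w)$, each in decreasing order of $w$'s true preference. A woman $w$ is called *weakly better-off* if $N(w)$ contains no man whom $w$ truly blacklists, $|O(w)|\le |N(w)|$, and for each $1\le i\le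 |O(w)|$ she does not truly prefer $o^w_i$ over $n^w_i$. A man $m$ *has gained only worse matches* if he prefers each member of $O(m)$ over each member of $N(m)\setminus O(m)$. If every woman in $L$ is weakly better-off, then (a) every woman in $W$ is weakly better-off, and (b) every man in $M$ has gained only worse matches. -/

import Mathlib

/-- The preferences of one person over the members `α` of the other side: a strict total order
(`prefers x y` means that `x` is strictly preferred over `y`) and a set of blacklisted people.
How blacklisted people are ordered never matters. -/
structure PrefList (α : Type*) where
  prefers : α → α → Prop
  strictTotal : IsStrictTotalOrder α prefers
  blacklist : Set α

namespace PrefList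

variable {α : Type*}

/-- The `n` most preferred elements of the finite set `S` (all of `S` if it has fewer than `n`
elements): those over which fewer than `n` elements of `S` are preferred. -/
def top (P : PrefList α) (n : ℕ) (S : Set α) : Set α :=
  {x | x ∈ S ∧ {y | y ∈ S ∧ P.prefers y x}.ncard < n}

/-- `x` is the `i`-th most preferred element of the finite set `S`, counting from `1`. -/
def IsNth (P : PrefList α) (S : Set α) (i : ℕ) (x : α) : Prop :=
  x ∈ S ∧ {y | y ∈ S ∧ P.prefers y x}.ncard + 1 = i

/-- A woman with true preferences `P`, original matches `O` and new matches `N` is weakly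
better-off. -/
def WeaklyBetterOff (P : PrefList α) (O N : Set α) : Prop :=
  (∀ x ∈ N, x ∉ P.blacklist) ∧
  O.ncard ≤ N.ncard ∧
  ∀ i : ℕ, 1 ≤ i → i ≤ O.ncard → ∀ x y : α, P.IsNth O i x → P.IsNth N i y → ¬ P.prefers x y

/-- A man with preferences `P`, original matches `O` and new matches `N` has gained only worse
matches. -/
def GainedOnlyWorse (P : PrefList α) (O N : Set α) : Prop :=
  ∀ x ∈ O, ∀ y ∈ N \ O, P.prefers x y

end PrefList

/-- An input of the algorithm: everybody's preferences (with blacklists) and quotas. -/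
structure Market (W M : Type*) where
  womenPref : W → PrefList M
  menPref : M → PrefList W
  womenQuota : W → ℕ
  menQuota : M → ℕ

namespace Market

variable {W M : Type*}

/-- The same market, in which the women declare the preferences `d`. -/
def declare (G : Market W M) (d : W → PrefList M) : Market W M :=
  { G with womenPref := d }

/-- The women whom `m` may still serenade, when `R` is the set of pairs `(w, m)` such that `w`
has already rejected `m`. -/
def available (G : Market W M) (R : Set (W × M)) (m : M) : Set W :=
  {w | (w, m) ∉ R ∧ m ∉ (G.womenPref w).blacklist ∧ w ∉ (G.menPref m).blacklist}

/-- The men who serenade under the window of `w` on a night before which the rejections `R`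
have taken place. -/
def serenaders (G : Market W M) (R : Set (W × M)) (w : W) : Set M :=
  {m | w ∈ (G.menPref m).top (G.menQuota m) (G.available R m)}

/-- The rejections on a night before which the rejections `R` have taken place. -/
def newRejections (G : Market W M) (R : Set (W × M)) : Set (W × M) :=
  {p | p.2 ∈ G.serenaders R p.1 ∧
    p.2 ∉ (G.womenPref p.1).top (G.womenQuota p.1) (G.serenaders R p.1)}

/-- The rejections that have taken place before night `t` (nights are numbered from `0`). -/
def rejectedBefore (G : Market W M) : ℕ → Set (W × M)
  | 0 => ∅
  | t + 1 => G.rejectedBefore t ∪ G.newRejections (G.rejectedBefore t)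

theorem newRejections_disjoint (G : Market W M) (R : Set (W × M)) :
    ∀ p ∈ G.newRejections R, p ∉ R :=
  fun _ hp => hp.1.1.1

/-- The algorithm stops: on some night nobody is rejected. -/
theorem exists_night_without_rejection [Finite W] [Finite M] (G : Market W M) :
    ∃ t, G.newRejections (G.rejectedBefore t) = ∅ := by
  by_contra h
  push Not at h
  have key : ∀ t, t ≤ (G.rejectedBefore t).ncard := by
    intro t
    induction t with
    | zero => exact Nat.zero_le _
    | succ t ih =>
      obtain ⟨p, hp⟩ := h t
      have hlt : (G.rejectedBefore t).ncard < (G.rejectedBefore (t + 1)).ncard := by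
        refine Set.ncard_lt_ncard ⟨Set.subset_union_left, fun hsub => ?_⟩ (Set.toFinite _)
        exact G.newRejections_disjoint _ p hp (hsub (Or.inr hp))
      omega
  have h1 := key (Nat.card (W × M) + 1)
  have h2 := Set.ncard_le_card (G.rejectedBefore (Nat.card (W × M) + 1))
  omega

open Classical in
/-- The night on which the algorithm stops: the first night without a rejection. -/
noncomputable def lastNight [Finite W] [Finite M] (G : Market W M) : ℕ :=
  Nat.find G.exists_night_without_rejection

/-- The men matched with `w` by the algorithm. -/
def husbands [Finite W] [Finite M] (G : Market W M) (w : W) : Set M :=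
  G.serenaders (G.rejectedBefore G.lastNight) w

/-- The women matched with `m` by the algorithm. -/
def wives [Finite W] [Finite M] (G : Market W M) (m : M) : Set W :=
  {w | m ∈ G.husbands w}

end Market

/-! Let `N` be the new matching. Everything follows once no pair of `N` was rejected in the true run
(`improved_eq_empty`). Then a man's new woman never rejected him, so she ranks below all his
original matches; and a truthful woman who loses a man must have a full set of better ones.

A woman matched in `N` with a man she had rejected had a full set of better husbands, so
`not_weaklyBetterOff` shows that she is no liar, and stability of `N` applies to her true
preferences. Double counting rejected new pairs against lost pairs (`improved_structure`) makes
every improved man full, with his worst original wife lost. The last such man to reach his original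
wives then yields a contradiction. -/

namespace PrefList

/-! ### Choosing the best elements from a finite set. -/

variable {α : Type*} (P : PrefList α)

theorem irrefl (x : α) : ¬ P.prefers x x :=
  have := P.strictTotal
  irrefl_of P.prefers x

theorem trans {x y z : α} (h : P.prefers x y) (h' : P.prefers y z) : P.prefers x z :=
  have := P.strictTotal
  trans_of P.prefers h h'

theorem asymm {x y : α} (h : P.prefers x y) : ¬ P.prefers y x :=
  fun h' => P.irrefl x (P.trans h h')

theorem total {x y : α} (h : x ≠ y) : P.prefers x y ∨ P.prefers y x := by
  have := P.strictTotal
  rcases trichotomous_of P.prefers x y with h' | h' | h'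
  exacts [Or.inl h', (h h').elim, Or.inr h']

/-- A preference list with all preferences reversed. -/
def reverse : PrefList α where
  prefers x y := P.prefers y x
  strictTotal :=
    { trichotomous := fun x y h h' => by
        by_contra hne
        exact (P.total hne).elim h' h
      irrefl := P.irrefl
      trans := fun _ _ _ h h' => P.trans h' h }
  blacklist := P.blacklist

theorem exists_best [Finite α] {S : Set α} (hS : S.Nonempty) :
    ∃ x ∈ S, ∀ y ∈ S, y ≠ x → P.prefers x y := by
  have := P.strictTotal
  have wf : WellFounded P.prefers := Finite.wellFounded_of_trans_of_irrefl P.prefers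
  refine ⟨wf.min S hS, wf.min_mem S hS, fun y hy hne => ?_⟩
  exact (P.total hne).resolve_left (wf.not_lt_min S hy)

theorem exists_worst [Finite α] {S : Set α} (hS : S.Nonempty) :
    ∃ x ∈ S, ∀ y ∈ S, y ≠ x → P.prefers y x :=
  P.reverse.exists_best hS

theorem mem_top_of_subset [Finite α] {n : ℕ} {S T : Set α} (hTS : T ⊆ S) {x : α}
    (hx : x ∈ P.top n S) (hxT : x ∈ T) : x ∈ P.top n T :=
  ⟨hxT, lt_of_le_of_lt (Set.ncard_le_ncard (by exact fun _ h => ⟨hTS h.1, h.2⟩) (Set.toFinite _)) hx.2⟩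

theorem mem_top_of_prefers [Finite α] {n : ℕ} {S : Set α} {x y : α}
    (hx : x ∈ P.top n S) (hy : y ∈ S) (hyx : P.prefers y x) : y ∈ P.top n S :=
  ⟨hy, lt_of_le_of_lt
    (Set.ncard_le_ncard (by exact fun _ h => ⟨h.1, P.trans h.2 hyx⟩) (Set.toFinite _)) hx.2⟩

theorem ncard_top_le [Finite α] (n : ℕ) (S : Set α) : (P.top n S).ncard ≤ n := by
  rcases (P.top n S).eq_empty_or_nonempty with h | h
  · simp [h]
  · obtain ⟨x, hx, hworst⟩ := P.exists_worst h
    have h1 : P.top n S \ {x} ⊆ {y | y ∈ S ∧ P.prefers y x} :=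
      fun y hy => ⟨hy.1.1, hworst y hy.1 hy.2⟩
    have h2 := Set.ncard_le_ncard h1 (Set.toFinite _)
    have h3 := Set.ncard_sdiff_singleton_add_one hx (Set.toFinite _)
    have h4 := hx.2
    omega

theorem le_ncard_top [Finite α] {n : ℕ} {S : Set α} (hn : n ≤ S.ncard) :
    n ≤ (P.top n S).ncard := by
  by_contra! hlt
  have hne : (S \ P.top n S).Nonempty := by
    rw [Set.sdiff_nonempty]
    intro hsub
    have := Set.ncard_le_ncard hsub (Set.toFinite _)
    omega
  obtain ⟨x, hx, hbest⟩ := P.exists_best hne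
  refine hx.2 ⟨hx.1, (Set.ncard_le_ncard (fun y hy => ?_) (Set.toFinite _)).trans_lt hlt⟩
  by_contra hy'
  have hyx : y ≠ x := fun h => P.irrefl x (h ▸ hy.2)
  exact P.asymm hy.2 (hbest y ⟨hy.1, hy'⟩ hyx)

theorem top_full [Finite α] {n : ℕ} {S : Set α} {x : α}
    (hn : n ≤ {y | y ∈ S ∧ P.prefers y x}.ncard) :
    (P.top n S).ncard = n ∧ ∀ z ∈ P.top n S, P.prefers z x := by
  refine ⟨le_antisymm (P.ncard_top_le n S) (P.le_ncard_top (hn.trans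
    (Set.ncard_le_ncard (fun _ hy => hy.1) (Set.toFinite _)))), fun z hz => ?_⟩
  by_contra hzx
  have hle : {y | y ∈ S ∧ P.prefers y x}.ncard ≤ {y | y ∈ S ∧ P.prefers y z}.ncard := by
    refine Set.ncard_le_ncard (fun y hy => ⟨hy.1, ?_⟩) (Set.toFinite _)
    by_cases hxz : x = z
    · exact hxz ▸ hy.2
    · exact P.trans hy.2 ((P.total hxz).resolve_right hzx)
  have := hz.2
  omega

theorem exists_isNth_ncard [Finite α] {S : Set α} (hS : S.Nonempty) :
    ∃ x, P.IsNth S S.ncard x ∧ ∀ y ∈ S, y ≠ x → P.prefers y x := by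
  obtain ⟨x, hx, hworst⟩ := P.exists_worst hS
  refine ⟨x, ⟨hx, ?_⟩, hworst⟩
  have : {y | y ∈ S ∧ P.prefers y x} = S \ {x} := by
    ext y
    exact ⟨fun h => ⟨h.1, fun h' => P.irrefl x (Set.mem_singleton_iff.1 h' ▸ h.2)⟩,
      fun h => ⟨h.1, hworst y h.1 h.2⟩⟩
  rw [this]
  exact Set.ncard_sdiff_singleton_add_one hx (Set.toFinite _)

/-- A woman is not weakly better-off if she gets no more matches than before, one of which is worse
than all original ones. -/
theorem not_weaklyBetterOff [Finite α] {O N : Set α} {y : α} (hcard : N.ncard ≤ O.ncard)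
    (hy : y ∈ N) (hlt : ∀ x ∈ O, P.prefers x y) : ¬ P.WeaklyBetterOff O N := by
  rintro ⟨-, hle, hnth⟩
  have heq := le_antisymm hle hcard
  have hN : 0 < N.ncard := (Set.ncard_pos (Set.toFinite _)).2 ⟨y, hy⟩
  obtain ⟨a, ha, -⟩ := P.exists_isNth_ncard ((Set.ncard_pos (Set.toFinite O)).1 (heq ▸ hN))
  obtain ⟨b, hb, hworst⟩ := P.exists_isNth_ncard ⟨y, hy⟩
  rw [← heq] at hb
  refine hnth _ (heq ▸ hN) le_rfl a b ha hb ?_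
  by_cases hyb : y = b
  · exact hyb ▸ hlt a ha.1
  · exact P.trans (hlt a ha.1) (hworst y hy hyb)

/-- If the `i`-th element of `O` beat the `i`-th element `y` of `N`, the best `i` elements of `O`
would all beat `y`, hence not be lost, and `y` would rank below `i` elements of `N`. -/
theorem weaklyBetterOff_of_lost_worse [Finite α] {O N : Set α}
    (hN : ∀ x ∈ N, x ∉ P.blacklist) (hcard : O.ncard ≤ N.ncard)
    (hlost : ∀ x ∈ O \ N, ∀ y ∈ N, P.prefers y x) : P.WeaklyBetterOff O N := by
  refine ⟨hN, hcard, fun i _ _ x y hx hy hxy => ?_⟩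
  have hsub : insert x {z | z ∈ O ∧ P.prefers z x} ⊆ {z | z ∈ N ∧ P.prefers z y} := by
    intro z hz
    have hz' : z ∈ O ∧ P.prefers z y := by
      rcases hz with rfl | hz
      exacts [⟨hx.1, hxy⟩, ⟨hz.1, P.trans hz.2 hxy⟩]
    refine ⟨?_, hz'.2⟩
    by_contra hzN
    exact P.asymm hz'.2 (hlost z ⟨hz'.1, hzN⟩ y hy.1)
  have h1 := Set.ncard_le_ncard hsub (Set.toFinite _)
  rw [Set.ncard_insert_of_notMem (fun h => P.irrefl x h.2) (Set.toFinite _), hx.2] at h1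
  have := hy.2
  omega

end PrefList

theorem sum_ncard_comm {W M : Type*} [Fintype W] [Fintype M] (r : W → M → Prop) :
    ∑ w, {m | r w m}.ncard = ∑ m, {w | r w m}.ncard := by
  classical
  have h := Finset.sum_card_bipartiteAbove_eq_sum_card_bipartiteBelow
    (s := (Finset.univ : Finset W)) (t := (Finset.univ : Finset M)) r
  simpa [Finset.bipartiteAbove, Finset.bipartiteBelow, Set.ncard_eq_toFinset_card'] using h

/-- If the relation `P` has at least as many pairs as `B` at each `w` and at most as many at each
`m`, then it has equally many at each `m`. -/
theorem ncard_eq_of_ncard_le {W M : Type*} [Finite W] [Finite M] {B P : W → M → Prop}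
    (hW : ∀ w, {m | B w m}.ncard ≤ {m | P w m}.ncard)
    (hM : ∀ m, {w | P w m}.ncard ≤ {w | B w m}.ncard) (m : M) :
    {w | P w m}.ncard = {w | B w m}.ncard := by
  have := Fintype.ofFinite W
  have := Fintype.ofFinite M
  have h1 : ∑ w, {m | B w m}.ncard ≤ ∑ w, {m | P w m}.ncard := Finset.sum_le_sum fun w _ => hW w
  rw [sum_ncard_comm B, sum_ncard_comm P] at h1
  have h2 := le_antisymm (Finset.sum_le_sum fun m _ => hM m) h1
  exact (Finset.sum_eq_sum_iff_of_le fun m _ => hM m).1 h2 m (Finset.mem_univ m)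

/-! ### Monotonicity of the algorithm and stability of its outcome. -/

namespace Market

variable {W M : Type*} (G : Market W M)

/-- Neither of `w` and `m` blacklists the other. -/
def Acceptable (w : W) (m : M) : Prop :=
  m ∉ (G.womenPref w).blacklist ∧ w ∉ (G.menPref m).blacklist

theorem rejectedBefore_mono : Monotone G.rejectedBefore :=
  monotone_nat_of_le_succ fun _ => Set.subset_union_left

theorem available_anti {R R' : Set (W × M)} (h : R ⊆ R') (m : M) :
    G.available R' m ⊆ G.available R m :=
  fun _ hw => ⟨fun hR => hw.1 (h hR), hw.2⟩

theorem acceptable_of_mem_serenaders {R : Set (W × M)} {w : W} {m : M}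
    (h : m ∈ G.serenaders R w) : G.Acceptable w m := h.1.2

variable [Finite W]

/-- Further rejections only shrink a man's choice, so he keeps serenading a woman until she rejects
him. -/
theorem mem_serenaders_of_subset {R R' : Set (W × M)} (h : R ⊆ R') {w : W} {m : M}
    (hm : m ∈ G.serenaders R w) (hR' : (w, m) ∉ R') : m ∈ G.serenaders R' w :=
  (G.menPref m).mem_top_of_subset (G.available_anti h m) hm ⟨hR', hm.1.2⟩

/-- The men whom `w` does not reject on night `t`. -/
def kept (G : Market W M) (t : ℕ) (w : W) : Set M :=
  (G.womenPref w).top (G.womenQuota w) (G.serenaders (G.rejectedBefore t) w)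

theorem kept_subset_serenaders_succ (t : ℕ) (w : W) :
    G.kept t w ⊆ G.serenaders (G.rejectedBefore (t + 1)) w := by
  intro m hm
  refine G.mem_serenaders_of_subset (G.rejectedBefore_mono t.le_succ) hm.1 ?_
  rintro (h | h)
  exacts [hm.1.1.1 h, h.2 hm]

variable [Finite M]

theorem newRejections_lastNight : G.newRejections (G.rejectedBefore G.lastNight) = ∅ := by
  classical
  exact Nat.find_spec G.exists_night_without_rejection

theorem rejectedBefore_subset (t : ℕ) : G.rejectedBefore t ⊆ G.rejectedBefore G.lastNight := by
  have h : ∀ k, G.rejectedBefore (G.lastNight + k) = G.rejectedBefore G.lastNight := by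
    intro k
    induction k with
    | zero => rfl
    | succ k ih =>
      change G.rejectedBefore (G.lastNight + k) ∪
        G.newRejections (G.rejectedBefore (G.lastNight + k)) = _
      rw [ih, newRejections_lastNight, Set.union_empty]
  rw [← h t]
  exact G.rejectedBefore_mono (Nat.le_add_left t _)

/-- A woman who has rejected `m` by night `t` keeps a full set of better men on that night. -/
theorem kept_full {t : ℕ} {w : W} {m : M} (h : (w, m) ∈ G.rejectedBefore (t + 1)) :
    (G.kept t w).ncard = G.womenQuota w ∧ ∀ z ∈ G.kept t w, (G.womenPref w).prefers z m := by
  refine (G.womenPref w).top_full ?_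
  induction t with
  | zero =>
    rcases h with h | h
    · exact h.elim
    · exact not_lt.1 fun h' => h.2 ⟨h.1, h'⟩
  | succ t ih =>
    rcases h with h | h
    · obtain ⟨h1, h2⟩ := (G.womenPref w).top_full (ih h)
      rw [← h1]
      exact Set.ncard_le_ncard (fun z hz => ⟨G.kept_subset_serenaders_succ t w hz, h2 z hz⟩)
        (Set.toFinite _)
    · exact not_lt.1 fun h' => h.2 ⟨h.1, h'⟩

theorem husbands_eq_kept (w : W) : G.husbands w = G.kept G.lastNight w := by
  refine Set.Subset.antisymm (fun m hm => ?_) (fun m hm => hm.1)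
  by_contra h
  exact (Set.eq_empty_iff_forall_notMem.1 G.newRejections_lastNight) (w, m) ⟨hm, h⟩

theorem ncard_husbands_le (w : W) : (G.husbands w).ncard ≤ G.womenQuota w := by
  rw [husbands_eq_kept]
  exact PrefList.ncard_top_le _ _ _

theorem ncard_wives_le (m : M) : (G.wives m).ncard ≤ G.menQuota m :=
  (G.menPref m).ncard_top_le _ _

theorem husbands_full {w : W} {m : M} (h : (w, m) ∈ G.rejectedBefore G.lastNight) :
    (G.husbands w).ncard = G.womenQuota w ∧ ∀ z ∈ G.husbands w, (G.womenPref w).prefers z m := by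
  rw [husbands_eq_kept]
  exact G.kept_full (Or.inl h)

theorem wives_full {w : W} {m : M} (hacc : G.Acceptable w m)
    (hR : (w, m) ∉ G.rejectedBefore G.lastNight) (hw : w ∉ G.wives m) :
    (G.wives m).ncard = G.menQuota m ∧ ∀ y ∈ G.wives m, (G.menPref m).prefers y w :=
  (G.menPref m).top_full (not_lt.1 fun h => hw ⟨⟨hR, hacc⟩, h⟩)

/-- The pair of `w` and `m` does not block the matching `N`: one of them has a full set of better
matches. -/
def NotBlocking (G : Market W M) (N : W → Set M) (w : W) (m : M) : Prop :=
  ((N w).ncard = G.womenQuota w ∧ ∀ z ∈ N w, (G.womenPref w).prefers z m) ∨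
  ({y | m ∈ N y}.ncard = G.menQuota m ∧ ∀ y ∈ {y | m ∈ N y}, (G.menPref m).prefers y w)

theorem notBlocking_husbands {w : W} {m : M} (hacc : G.Acceptable w m) (h : m ∉ G.husbands w) :
    G.NotBlocking G.husbands w m := by
  by_cases hR : (w, m) ∈ G.rejectedBefore G.lastNight
  · exact Or.inl (G.husbands_full hR)
  · exact Or.inr (G.wives_full hacc hR h)

/-- If `m` has a original match `w` who is worse than all his matches in `N`, then all his new
matches had rejected him. -/
theorem rejected_of_full {N : W → Set M} (hacc : ∀ w, ∀ m ∈ N w, G.Acceptable w m) {w : W} {m : M}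
    (hw : m ∈ G.husbands w) (hpref : ∀ y ∈ {y | m ∈ N y}, (G.menPref m).prefers y w)
    {y : W} (hy : m ∈ N y) (hyO : m ∉ G.husbands y) :
    (y, m) ∈ G.rejectedBefore G.lastNight := by
  by_contra hR
  exact (G.menPref m).asymm (hpref y hy) ((G.wives_full (hacc y m hy) hR hyO).2 w hw)

/-! ### Improved men: counting, and the last night on which one of them changes. -/

/-- The men who are matched in `N` with a woman who rejects them in the course of the algorithm. -/
def improved (G : Market W M) (N : W → Set M) : Set M :=
  {m | ∃ w, m ∈ N w ∧ (w, m) ∈ G.rejectedBefore G.lastNight}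

/-- A man whom a woman prefers over a match `b` of hers in `N`, and who is not matched
with her in `N`, has a full set of better matches in `N`. -/
theorem full_of_prefers {N : W → Set M}
    (hstable : ∀ w b, b ∈ N w → (w, b) ∈ G.rejectedBefore G.lastNight →
      ∀ m, G.Acceptable w m → m ∉ N w → G.NotBlocking N w m)
    {w : W} {b m : M} (hb : b ∈ N w) (hbR : (w, b) ∈ G.rejectedBefore G.lastNight)
    (hm : G.Acceptable w m) (hmN : m ∉ N w) (hmb : (G.womenPref w).prefers m b) :
    {y | m ∈ N y}.ncard = G.menQuota m ∧ ∀ y ∈ {y | m ∈ N y}, (G.menPref m).prefers y w :=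
  (hstable w b hb hbR m hm hmN).resolve_left fun h => (G.womenPref w).asymm hmb (h.2 b hb)

/-- Every improved man has a full set of original matches, prefers all his matches in `N` over his
worst original match, and all his lost matches are women who reject matches of theirs in `N`. -/
theorem improved_structure {N : W → Set M} (hacc : ∀ w, ∀ m ∈ N w, G.Acceptable w m)
    (hquota : ∀ w, (N w).ncard ≤ G.womenQuota w)
    (hstable : ∀ w b, b ∈ N w → (w, b) ∈ G.rejectedBefore G.lastNight →
      ∀ m, G.Acceptable w m → m ∉ N w → G.NotBlocking N w m)
    {m : M} (hm : m ∈ G.improved N) :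
    (G.wives m).ncard = G.menQuota m ∧
    (∃ w, m ∈ G.husbands w ∧ ∀ y ∈ {y | m ∈ N y}, (G.menPref m).prefers y w) ∧
    ∀ w, m ∈ G.husbands w → m ∉ N w →
      ∃ b ∈ N w, (w, b) ∈ G.rejectedBefore G.lastNight := by
  let R := G.rejectedBefore G.lastNight
  let B : W → M → Prop := fun w m => m ∈ N w ∧ (w, m) ∈ R
  let P : W → M → Prop := fun w m => (∃ b, B w b) ∧ m ∈ G.husbands w ∧ m ∉ N w
  have hnotO : ∀ {w m}, (w, m) ∈ R → m ∉ G.husbands w := fun hR h => h.1.1 hR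
  have hfull : ∀ {w m}, P w m →
      {y | m ∈ N y}.ncard = G.menQuota m ∧ ∀ y ∈ {y | m ∈ N y}, (G.menPref m).prefers y w := by
    rintro w m ⟨⟨b, hb, hbR⟩, hmO, hmN⟩
    exact G.full_of_prefers hstable hb hbR (G.acceptable_of_mem_serenaders hmO) hmN
      ((G.husbands_full hbR).2 m hmO)
  have hBeq : ∀ {w m}, P w m → {y | B y m} = {y | m ∈ N y} \ G.wives m := by
    intro w m hP
    ext y
    exact ⟨fun h => ⟨h.1, hnotO h.2⟩,
      fun h => ⟨h.1, G.rejected_of_full hacc hP.2.1 (hfull hP).2 h.1 h.2⟩⟩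
  have hlost : ∀ {w m}, P w m →
      (G.wives m \ {y | m ∈ N y}).ncard ≤ {y | B y m}.ncard := by
    intro w m hP
    rw [hBeq hP, ← Set.ncard_le_ncard_iff_ncard_sdiff_le_ncard_sdiff, (hfull hP).1]
    exact G.ncard_wives_le m
  have hPsub : ∀ m, {w | P w m} ⊆ G.wives m \ {y | m ∈ N y} := fun m w h => h.2
  -- A woman in `B` was full originally, so she loses at least as many men as she gains; a man in
  -- `P` is full in `N`, so he loses at most as many women as he gains. Hence equality throughout.
  have hcount := ncard_eq_of_ncard_le (B := B) (P := P) (fun w => by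
    by_cases hw : ∃ b, B w b
    · obtain ⟨b, hb⟩ := id hw
      have h1 : {m | P w m} = G.husbands w \ N w := by
        ext m
        exact ⟨fun h => h.2, fun h => ⟨hw, h⟩⟩
      have h2 : {m | B w m} ⊆ N w \ G.husbands w := fun m h => ⟨h.1, hnotO h.2⟩
      refine (Set.ncard_le_ncard h2 (Set.toFinite _)).trans ?_
      rw [h1, ← Set.ncard_le_ncard_iff_ncard_sdiff_le_ncard_sdiff, (G.husbands_full hb.2).1]
      exact hquota w
    · have : {m | B w m} = ∅ := Set.eq_empty_iff_forall_notMem.2 fun m h => hw ⟨m, h⟩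
      simp [this]) (fun m => by
    rcases {w | P w m}.eq_empty_or_nonempty with h | ⟨w, hw⟩
    · simp [h]
    · exact (Set.ncard_le_ncard (hPsub m) (Set.toFinite _)).trans (hlost hw)) m
  obtain ⟨y, hy⟩ := hm
  have hBpos : 0 < {w | B w m}.ncard := (Set.ncard_pos (Set.toFinite _)).2 ⟨y, hy⟩
  obtain ⟨w, hw⟩ := (Set.ncard_pos (Set.toFinite _)).1 (hcount ▸ hBpos)
  -- Equality of the counts leaves no lost woman of `m` outside `P`.
  have hPeq : {w | P w m} = G.wives m \ {y | m ∈ N y} :=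
    Set.eq_of_subset_of_ncard_le (hPsub m) (hcount ▸ hlost hw) (Set.toFinite _)
  refine ⟨?_, ⟨w, hw.2.1, (hfull hw).2⟩, fun w' hO hN => ?_⟩
  · rw [← (hfull hw).1]
    rw [hPeq, hBeq hw] at hcount
    refine le_antisymm ?_ ?_
    · rw [Set.ncard_le_ncard_iff_ncard_sdiff_le_ncard_sdiff, hcount]
    · rw [Set.ncard_le_ncard_iff_ncard_sdiff_le_ncard_sdiff, hcount]
  · have h : w' ∈ {w | P w m} := hPeq ▸ ⟨hO, hN⟩
    exact h.1

/-- A matching that respects the quotas of the women and the blacklists, and is blocked by no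
woman who rejects one of her matches in the course of the algorithm, has no such woman. -/
theorem improved_eq_empty {N : W → Set M} (hacc : ∀ w, ∀ m ∈ N w, G.Acceptable w m)
    (hquota : ∀ w, (N w).ncard ≤ G.womenQuota w)
    (hstable : ∀ w b, b ∈ N w → (w, b) ∈ G.rejectedBefore G.lastNight →
      ∀ m, G.Acceptable w m → m ∉ N w → G.NotBlocking N w m) :
    G.improved N = ∅ := by
  classical
  by_contra hne
  obtain ⟨m', hm'⟩ := Set.nonempty_iff_ne_empty.2 hne
  have hstr := fun {m} (hm : m ∈ G.improved N) => G.improved_structure hacc hquota hstable hm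
  let S : ℕ → M → Set W := fun t m => {w | m ∈ G.serenaders (G.rejectedBefore t) w}
  have hSle : ∀ t m, (S t m).ncard ≤ G.menQuota m := fun t m => (G.menPref m).ncard_top_le _ _
  let Settled : ℕ → Prop := fun t => ∀ m ∈ G.improved N, S t m = G.wives m
  have hex : ∃ t, Settled t := ⟨G.lastNight, fun m _ => rfl⟩
  have hsettled := Nat.find_spec hex
  -- Once settled, `m` serenades an original wife worse than `w`, so `w` must have rejected him
  -- already.
  have hrej : ∀ w m, m ∈ N w → (w, m) ∈ G.rejectedBefore G.lastNight →
      (w, m) ∈ G.rejectedBefore (Nat.find hex) := by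
    intro w m hN hR
    have hm : m ∈ G.improved N := ⟨w, hN, hR⟩
    by_contra hnR
    obtain ⟨-, ⟨o, ho, hpref⟩, -⟩ := hstr hm
    have ho' : o ∈ S (Nat.find hex) m := hsettled m hm ▸ ho
    have hw : w ∈ S (Nat.find hex) m :=
      (G.menPref m).mem_top_of_prefers ho' ⟨hnR, hacc w m hN⟩ (hpref w hN)
    rw [hsettled m hm] at hw
    exact hw.1.1 hR
  obtain ⟨s, hs⟩ : ∃ s, Nat.find hex = s + 1 := by
    refine Nat.exists_eq_succ_of_ne_zero fun h0 => ?_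
    obtain ⟨w, hw⟩ := hm'
    have := hrej w m' hw.1 hw.2
    rw [h0] at this
    exact this
  rw [hs] at hsettled hrej
  have hns : ¬ Settled s := Nat.find_min hex (by omega)
  simp only [Settled, not_forall] at hns
  obtain ⟨m₀, hm₀, hSne⟩ := hns
  obtain ⟨hfull₀, ⟨o, ho, hpref⟩, hlost⟩ := hstr hm₀
  obtain ⟨w₁, hw₁, hworst⟩ := (G.menPref m₀).exists_worst (S := G.wives m₀) ⟨o, ho⟩
  have hw₁N : m₀ ∉ N w₁ := by
    intro h
    have h1 := hpref w₁ h
    by_cases how : o = w₁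
    · exact (G.menPref m₀).irrefl o (by rw [← how] at h1; exact h1)
    · exact (G.menPref m₀).asymm h1 (hworst o ho how)
  -- Serenading his worst original wife would mean serenading all of them, which fills his quota: he
  -- would be settled on night `s`.
  have hw₁S : m₀ ∉ G.serenaders (G.rejectedBefore s) w₁ := by
    intro h
    refine hSne (Set.eq_of_subset_of_ncard_le (fun y hy => ?_) ?_ (Set.toFinite _)).symm
    · by_cases hyw : y = w₁
      · exact hyw ▸ h
      · exact (G.menPref m₀).mem_top_of_prefers h
          (G.available_anti (G.rejectedBefore_subset s) m₀ hy.1) (hworst y hy hyw)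
    · exact hfull₀ ▸ hSle s m₀
  obtain ⟨b, hb, hbR⟩ := hlost w₁ hw₁ hw₁N
  obtain ⟨hkcard, hkpref⟩ := G.kept_full (hrej w₁ b hb hbR)
  -- `w₁` is already full on night `s` without `m₀`, so his later arrival displaces some `m₁`.
  obtain ⟨m₁, hm₁k, hm₁O⟩ : ∃ m₁ ∈ G.kept s w₁, m₁ ∉ G.husbands w₁ := by
    by_contra! h
    have := Set.eq_of_subset_of_ncard_le h (hkcard ▸ G.ncard_husbands_le w₁) (Set.toFinite _)
    have hmem : m₀ ∈ G.kept s w₁ := this ▸ hw₁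
    exact hw₁S hmem.1
  have hm₁S := G.kept_subset_serenaders_succ s w₁ hm₁k
  have hm₁R : (w₁, m₁) ∈ G.rejectedBefore G.lastNight := by
    by_contra h
    exact hm₁O (G.mem_serenaders_of_subset (G.rejectedBefore_subset _) hm₁S h)
  have hm₁N : m₁ ∉ N w₁ := fun h => hm₁S.1.1 (hrej w₁ m₁ h hm₁R)
  obtain ⟨hfull₁, hpref₁⟩ := G.full_of_prefers hstable hb hbR
    (G.acceptable_of_mem_serenaders hm₁S) hm₁N (hkpref m₁ hm₁k)
  -- Otherwise his full set of new women, all better than `w₁`, would still be available, and he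
  -- would not serenade `w₁`.
  have himp : m₁ ∈ G.improved N := by
    by_contra hnot
    have hsub : {y | m₁ ∈ N y} ⊆ {y | y ∈ G.available (G.rejectedBefore (s + 1)) m₁ ∧
        (G.menPref m₁).prefers y w₁} := fun y hy =>
      ⟨⟨fun h => hnot ⟨y, hy, G.rejectedBefore_subset _ h⟩, hacc y m₁ hy⟩, hpref₁ y hy⟩
    have h1 := Set.ncard_le_ncard hsub (Set.toFinite _)
    exact absurd hm₁S.2 (not_lt.2 (hfull₁ ▸ h1))
  have hw₁m₁ : w₁ ∈ S (s + 1) m₁ := hm₁S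
  rw [hsettled m₁ himp] at hw₁m₁
  exact hm₁O hw₁m₁

end Market

theorem mainTheorem3 {W M : Type*} [Finite W] [Finite M]
    (G : Market W M) (L : Set W) (d : W → PrefList M)
    (hInnocent : ∀ w, w ∉ L → d w = G.womenPref w)
    (hLiars : ∀ w ∈ L,
      (G.womenPref w).WeaklyBetterOff (G.husbands w) ((G.declare d).husbands w)) :
    (∀ w : W, (G.womenPref w).WeaklyBetterOff (G.husbands w) ((G.declare d).husbands w)) ∧
    (∀ m : M, (G.menPref m).GainedOnlyWorse (G.wives m) ((G.declare d).wives m)) := by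
  have hacc : ∀ w, ∀ m ∈ (G.declare d).husbands w, G.Acceptable w m := by
    intro w m hm
    have h := (G.declare d).acceptable_of_mem_serenaders hm
    refine ⟨?_, h.2⟩
    by_cases hw : w ∈ L
    · exact (hLiars w hw).1 m hm
    · have h1 : m ∉ (d w).blacklist := h.1
      rwa [hInnocent w hw] at h1
  have hstable : ∀ w, w ∉ L → ∀ m, G.Acceptable w m → m ∉ (G.declare d).husbands w →
      G.NotBlocking (G.declare d).husbands w m := by
    intro w hw m hm hmN
    have hd : (G.declare d).womenPref w = G.womenPref w := hInnocent w hw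
    have h := (G.declare d).notBlocking_husbands (w := w) (m := m) ⟨hd ▸ hm.1, hm.2⟩ hmN
    rw [Market.NotBlocking, hd] at h
    exact h
  have hquota : ∀ w, ((G.declare d).husbands w).ncard ≤ G.womenQuota w :=
    (G.declare d).ncard_husbands_le
  have hempty := G.improved_eq_empty hacc hquota fun w b hb hbR m hm hmN => by
    obtain ⟨hfull, hpref⟩ := G.husbands_full hbR
    exact hstable w (fun hw => (G.womenPref w).not_weaklyBetterOff (hfull ▸ hquota w) hb hpref
      (hLiars w hw)) m hm hmN
  have hnot : ∀ w m, m ∈ (G.declare d).husbands w → (w, m) ∉ G.rejectedBefore G.lastNight :=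
    fun w m hm hR => Set.eq_empty_iff_forall_notMem.1 hempty m ⟨w, hm, hR⟩
  refine ⟨fun w => ?_, fun m x hx y hy =>
    (G.wives_full (hacc y m hy.1) (hnot y m hy.1) hy.2).2 x hx⟩
  by_cases hw : w ∈ L
  · exact hLiars w hw
  have hlost : ∀ m ∈ G.husbands w \ (G.declare d).husbands w,
      ((G.declare d).husbands w).ncard = G.womenQuota w ∧
        ∀ z ∈ (G.declare d).husbands w, (G.womenPref w).prefers z m := by
    rintro m ⟨hmO, hmN⟩
    refine (hstable w hw m (G.acceptable_of_mem_serenaders hmO) hmN).resolve_right ?_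
    rintro ⟨hfull, hpref⟩
    -- Having lost `w` while being full in the new matching, `m` has a woman who is new to him; she
    -- must have rejected him in the true run.
    obtain ⟨y, hy, hyO⟩ : ∃ y ∈ {y | m ∈ (G.declare d).husbands y}, y ∉ G.wives m := by
      by_contra! h
      have := Set.eq_of_subset_of_ncard_le h (hfull ▸ G.ncard_wives_le m) (Set.toFinite _)
      have hw' : w ∈ {y | m ∈ (G.declare d).husbands y} := this ▸ hmO
      exact hmN hw'
    exact hnot y m hy (G.rejected_of_full hacc hmO hpref hy hyO)
  refine PrefList.weaklyBetterOff_of_lost_worse _ (fun m hm => (hacc w m hm).1) ?_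
    fun x hx => (hlost x hx).2
  by_cases hsub : G.husbands w ⊆ (G.declare d).husbands w
  · exact Set.ncard_le_ncard hsub (Set.toFinite _)
  · obtain ⟨x, hx, hxN⟩ := Set.not_subset.1 hsub
    rw [(hlost x ⟨hx, hxN⟩).1]
    exact G.ncard_husbands_le w
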